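/- Let $K$ be a complete discrete valuation field whose residue field $k$ is perfect, of characteristic $p \ge 0$, and assume that for every prime $\ell \neq p$ no finite extension of $k$ contains all the roots of unity of $\ell$-power order. Let $G_K = \mathrm{Gal}(K^{\mathrm{sep}}/K)$ and let $I_K \subset G_K$ be the inertia group. For each prime $\ell \neq p$ let $\rho_\ell$ be a continuous linear representation of $G_K$ on a finite-dimensional $\mathbb{Q}_\ell$-vector space $V_\ell$, and assume that $\mathrm{Tr}(\rho_\ell(s); V_\ell) = \mathrm{Tr}(\rho_{\ell'}(s); V_{\ell'}) \in \mathbb{Q}$ for all primes $\ell, \ell' \neq p$ and all $s \in I_K$. Then all the $V_\ell$ have the same dimension $d$, the subset $I = \{ s \in I_K \mid \rho_\ell(s) \text{ is unipotent} \}$ is a subgroup of $I_K$ which is independent of $\ell$, and the index $[I_K : I]$ is finite and divides $C_d = \gcd\{ C_{\ell,d} \mid \ell \neq p \text{ prime} \}$. Here $C_{\ell,d}$ denotes the order of $GL_d(\mathbb{F}_\ell)$ if $\ell \neq 2$, and the order of $GL_d(\mathbb{Z}/4\mathbb{Z})$ if $\ell = 2$. -/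

import Mathlib

/-- The primes `ℓ` different from `p` (with `p = 0` allowed: then these are all primes). -/
abbrev PrimeNe (p : ℕ) : Type := {ℓ : ℕ // ℓ.Prime ∧ ℓ ≠ p}

instance PrimeNe.factPrime (p : ℕ) (ℓ : PrimeNe p) : Fact (ℓ.1.Prime) := ⟨ℓ.2.1⟩

/-- `C_{ℓ,d}`: the order of `GL_d(𝔽_ℓ)` if `ℓ ≠ 2`, and of `GL_d(ℤ/4ℤ)` if `ℓ = 2`. -/
noncomputable def glOrder (ℓ d : ℕ) : ℕ :=
  if ℓ = 2 then Nat.card (GL (Fin d) (ZMod 4)) else Nat.card (GL (Fin d) (ZMod ℓ))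

/-- `C_d = gcd (C_{ℓ,d} ∣ ℓ ≠ p)`: the greatest natural number dividing `C_{ℓ,d}` for every
prime `ℓ ≠ p`. -/
noncomputable def glOrderGcd (p d : ℕ) : ℕ :=
  sSup {m : ℕ | ∀ ℓ : PrimeNe p, m ∣ glOrder ℓ.1 d}

theorem glOrder_pos {ℓ : ℕ} (hℓ : ℓ.Prime) (d : ℕ) : 0 < glOrder ℓ d := by
  unfold glOrder
  have : NeZero ℓ := ⟨hℓ.ne_zero⟩
  split_ifs
  · exact Nat.card_pos
  · exact Nat.card_pos

/-- `glOrderGcd` is the gcd in the sense of divisibility. -/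
theorem dvd_glOrderGcd_iff (p d n : ℕ) :
    n ∣ glOrderGcd p d ↔ ∀ ℓ : PrimeNe p, n ∣ glOrder ℓ.1 d := by
  obtain ⟨q, hq, hqp⟩ := Nat.exists_infinite_primes (p + 1)
  have hbd : BddAbove {m : ℕ | ∀ ℓ : PrimeNe p, m ∣ glOrder ℓ.1 d} :=
    ⟨glOrder q d, fun m hm => Nat.le_of_dvd (glOrder_pos hqp d) (hm ⟨q, hqp, by omega⟩)⟩
  have hmem : ∀ ℓ : PrimeNe p, glOrderGcd p d ∣ glOrder ℓ.1 d :=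
    Nat.sSup_mem (s := {m : ℕ | ∀ ℓ : PrimeNe p, m ∣ glOrder ℓ.1 d})
      ⟨1, fun ℓ => one_dvd _⟩ hbd
  refine ⟨fun h ℓ => h.trans (hmem ℓ), fun h => ?_⟩
  have hl : Nat.lcm n (glOrderGcd p d) ≤ glOrderGcd p d :=
    le_csSup hbd fun ℓ => Nat.lcm_dvd (h ℓ) (hmem ℓ)
  have hd : glOrderGcd p d ∣ Nat.lcm n (glOrderGcd p d) := Nat.dvd_lcm_right _ _
  have hpos : 0 < Nat.lcm n (glOrderGcd p d) := by
    refine Nat.pos_of_dvd_of_pos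
      (Nat.lcm_dvd (h ⟨q, hqp, by omega⟩) (hmem ⟨q, hqp, by omega⟩)) (glOrder_pos hqp d)
  have : Nat.lcm n (glOrderGcd p d) = glOrderGcd p d :=
    le_antisymm hl (Nat.le_of_dvd hpos hd)
  rw [← this]
  exact Nat.dvd_lcm_left _ _

/-- The condition `(C_ℓ)` on a field `k`: no finite extension of `k` contains all the roots of
unity of `ℓ`-power order. -/
def NoFiniteExtensionContainsRootsOfUnity (ℓ : ℕ) (k : Type*) [Field k] : Prop :=
  ∀ F : IntermediateField k (AlgebraicClosure k), FiniteDimensional k F →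
    ¬ ∀ (n : ℕ) (ζ : AlgebraicClosure k), ζ ^ (ℓ ^ n) = 1 → ζ ∈ F

/-- The inertia group of a complete discretely valued field `K` with valuation ring `R`: the
elements of `Gal(Ksep/K)` acting trivially on the residue field of the integral closure `B` of
`R` in `Ksep`. Since `R` is henselian, `B` is a local ring, so its Jacobson radical (the
intersection of all maximal ideals) is its maximal ideal. -/
noncomputable def inertiaGroup (R K Ksep : Type*) [CommRing R] [Field K] [Algebra R K]
    [Field Ksep] [Algebra K Ksep] [Algebra R Ksep] [IsScalarTower R K Ksep] :
    Subgroup Gal(Ksep/K) :=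
  (Ring.jacobson (integralClosure R Ksep)).inertia Gal(Ksep/K)

/-!
The rationality of the traces on the compact group `G = I_K` forces the quasi-unipotence of each
`ρ_ℓ`, by a Baire category argument, and at the same time describes the subgroup sought in terms of
the common character `τ : G → ℚ` alone: it is `leftPeriods τ`, the group of the `s` such that
`τ (s * t) = τ t` for all `t`.

Let `E` be the linear span of `ρ_ℓ(G)` in `End V_ℓ`. An element `s` is a left period of `τ` if and
only if `ρ_ℓ(s) - 1` is orthogonal to `E` for the trace form, which can be tested on finitely many
elements `ρ_ℓ(t_j)` spanning `E`. The cosets of `leftPeriods τ` are therefore the fibres of a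
map `s ↦ (τ (s * t_j))_j` from `G` to a countable set. They are closed because the trace is
`ℓ`-adically continuous, so one of them has an interior point, and the subgroup is open, of finite
index (`Representation.finiteIndex_leftPeriods`).

If `s` is a left period, then all powers of `ρ_ℓ(s) - 1` have trace zero, so `ρ_ℓ(s)` is unipotent.
Conversely, let `ρ_ℓ(s)` be unipotent. Some `s ^ m` with `m ≥ 1` is a left period, and
`ρ_ℓ(s) - 1` is a multiple, inside `E`, of `ρ_ℓ(s ^ m) - 1`; so it is orthogonal to `E` as well
(`Representation.mem_leftPeriods_iff`).

Finally, `G` stabilises a lattice of `V_ℓ`. An element acting trivially on the lattice modulo `ℓ`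
(modulo `4` if `ℓ = 2`) has a unipotent power, hence is unipotent by Minkowski's lemma
(`isNilpotent_of_isNilpotent_pow_sub_one`). So the subgroup contains the kernel of a homomorphism
from `G` to a group of order `C_{ℓ,d}` (`Representation.index_dvd_glOrder`).
-/

/-! ### Nilpotency and traces; the periods of a character -/

open Polynomial in
/-- In characteristic zero, an endomorphism all of whose positive powers have trace zero is
nilpotent: otherwise the projection onto the part of `V` where it is invertible would be a
polynomial in `x` without constant term, hence a nonzero idempotent of trace zero. -/
theorem Module.End.isNilpotent_of_forall_trace_pow_eq_zero {F V : Type*} [Field F] [CharZero F]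
    [AddCommGroup V] [Module F V] [FiniteDimensional F V] (x : Module.End F V)
    (hx : ∀ n : ℕ, LinearMap.trace F V (x ^ (n + 1)) = 0) : IsNilpotent x := by
  have htr : ∀ u : F[X], LinearMap.trace F V (aeval x (u * X)) = 0 := by
    intro u
    induction u using Polynomial.induction_on' with
    | add p q hp hq => rw [add_mul, map_add, map_add, hp, hq, add_zero]
    | monomial n a =>
      rw [monomial_mul_X, aeval_monomial, ← Algebra.smul_def, map_smul, hx, smul_zero]
  obtain ⟨g, hg, hgX⟩ := exists_eq_pow_rootMultiplicity_mul_and_not_dvd (minpoly F x)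
    (minpoly.ne_zero (Algebra.IsIntegral.isIntegral x)) 0
  set a := (minpoly F x).rootMultiplicity 0
  rw [C_0, sub_zero] at hg hgX
  obtain ⟨u, v, huv⟩ : IsCoprime (X ^ (a + 1)) g :=
    ((irreducible_X.coprime_iff_not_dvd).mpr hgX).pow_left
  have hmin : aeval x (X ^ a * g) = 0 := by rw [← hg, minpoly.aeval]
  -- This is the projection onto the part of `V` on which `x` is invertible.
  have he : IsIdempotentElem (aeval x (u * X ^ (a + 1))) := by
    have : u * X ^ (a + 1) * (u * X ^ (a + 1)) =
        u * X ^ (a + 1) - X ^ a * g * (u * v * X) := by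
      linear_combination (u * X ^ (a + 1)) * huv
    rw [IsIdempotentElem, ← map_mul, this, map_sub, map_mul _ (X ^ a * g), hmin, zero_mul, sub_zero]
  have he0 : aeval x (u * X ^ (a + 1)) = 0 := by
    refine LinearMap.IsIdempotentElem.eq_zero_of_trace_eq_zero he ?_
    rw [pow_succ, ← mul_assoc, htr]
  refine ⟨a, ?_⟩
  have : X ^ a = X ^ a * (u * X ^ (a + 1)) + X ^ a * g * v := by
    linear_combination (-X ^ a) * huv
  rw [← aeval_X_pow (R := F) x, this, map_add, map_mul, he0, map_mul, hmin, mul_zero, zero_mul,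
    add_zero]

/-- The subgroup of left periods of a function `f` on a group: the `s` such that `f (s * t) = f t`
for all `t`. When `f` is the character of a representation `ρ`, it is the group of the `s` such
that `ρ s - 1` lies in the radical of the trace form on the linear span of the image of `ρ`. -/
def leftPeriods {G α : Type*} [Group G] (f : G → α) : Subgroup G where
  carrier := {s | ∀ t, f (s * t) = f t}
  mul_mem' {a b} ha hb t := by rw [mul_assoc, ha, hb]
  one_mem' t := by rw [one_mul]
  inv_mem' {a} ha t := by rw [← ha, mul_inv_cancel_left]

section Representation

variable {G F V : Type*} [Group G] [Field F] [AddCommGroup V] [Module F V]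

/-- The left periods of a continuous rational-valued character of a compact group have finite
index. They are determined by finitely many values `τ (s * t e)`, where the `ρ (t e)` span the
image of `ρ`; so the group is covered by countably many closed sets on each of which `s` varies in
one coset only, and by Baire's theorem one of them has an interior point. -/
theorem Representation.finiteIndex_leftPeriods [FiniteDimensional F V] [CharZero F]
    [TopologicalSpace F] [T1Space F]
    [TopologicalSpace G] [IsTopologicalGroup G] [CompactSpace G]
    (ρ : Representation F G V) (τ : G → ℚ) (hτ : ∀ s, LinearMap.trace F V (ρ s) = τ s)
    (hcont : Continuous fun s => LinearMap.trace F V (ρ s)) : (leftPeriods τ).FiniteIndex := by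
  have hcast : Function.Injective ((↑) : ℚ → F) := Rat.cast_injective
  obtain ⟨S, hS, hspan⟩ := Submodule.fg_span_iff_fg_span_finset_subset _ |>.mp
    (IsNoetherian.noetherian (Submodule.span F (Set.range ρ)))
  choose t ht using fun e : S => hS e.2
  -- The fibres of `s ↦ (τ (s * t e))_e`, indexed by a countable set since `τ` is rational-valued.
  let C : (S → ℚ) → Set G := fun y => {s | ∀ e, τ (s * t e) = y e}
  have hdiv : ∀ y, ∀ s ∈ C y, ∀ s' ∈ C y, ∀ u, τ (s * u) = τ (s' * u) := by
    intro y s hs s' hs' u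
    have key : ∀ e ∈ Submodule.span F (Set.range ρ),
        LinearMap.trace F V (ρ s * e) = LinearMap.trace F V (ρ s' * e) := by
      intro e he
      rw [hspan] at he
      induction he using Submodule.span_induction with
      | mem e he =>
        rw [← (show ρ (t ⟨e, he⟩) = e from ht ⟨e, he⟩), ← map_mul, ← map_mul, hτ, hτ, hs ⟨e, he⟩,
          hs' ⟨e, he⟩]
      | zero => simp
      | add a b _ _ ha hb => rw [mul_add, mul_add, map_add, map_add, ha, hb]
      | smul c a _ ha => rw [mul_smul_comm, mul_smul_comm, map_smul, map_smul, ha]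
    have := key (ρ u) (Submodule.subset_span ⟨u, rfl⟩)
    rw [← map_mul, ← map_mul, hτ, hτ] at this
    exact hcast this
  have hclosed : ∀ y, IsClosed (C y) := by
    intro y
    have : C y = ⋂ e, (fun s => LinearMap.trace F V (ρ (s * t e))) ⁻¹' {(y e : F)} := by
      ext s
      simp only [C, hτ, Set.mem_ofPred_eq, Set.mem_iInter, Set.mem_preimage, Set.mem_singleton_iff,
        hcast.eq_iff]
    rw [this]
    exact isClosed_iInter fun e =>
      isClosed_singleton.preimage (hcont.comp (continuous_mul_const (t e)))
  obtain ⟨y, s₀, hs₀⟩ := nonempty_interior_of_iUnion_of_closed hclosed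
    (Set.eq_univ_of_forall fun s => Set.mem_iUnion.mpr ⟨fun e => τ (s * t e), fun _ => rfl⟩)
  have hopen : IsOpen (leftPeriods τ : Set G) := by
    refine Subgroup.isOpen_of_mem_nhds _ (g := 1) ?_
    have hm : C y ∈ nhds (1 * s₀) := by
      rw [one_mul]; exact mem_interior_iff_mem_nhds.mp hs₀
    filter_upwards [(continuous_mul_const s₀).continuousAt.preimage_mem_nhds hm] with s hs u
    have := hdiv y _ hs s₀ (interior_subset hs₀) (s₀⁻¹ * u)
    simpa [mul_assoc] using this
  have := Subgroup.quotient_finite_of_isOpen _ hopen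
  exact Subgroup.finiteIndex_of_finite_quotient

open Polynomial in
/-- If `x` is unipotent over a field of characteristic zero, then `x - 1` is a multiple of
`x ^ m - 1`, since `1 + x + ⋯ + x ^ (m - 1)` is `m` plus a nilpotent element, hence a unit. -/
theorem exists_aeval_mul_pow_sub_one {A : Type*} [Ring A] [Algebra F A] [CharZero F] {x : A}
    (hx : IsNilpotent (x - 1)) {m : ℕ} (hm : m ≠ 0) :
    ∃ a : F[X], x - 1 = (x ^ m - 1) * aeval x a := by
  obtain ⟨k, hk⟩ := hx
  have hcop : IsCoprime (∑ i ∈ Finset.range m, (X : F[X]) ^ i) ((X - C 1) ^ k) := by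
    refine IsCoprime.pow_right (IsCoprime.symm ?_)
    rw [(irreducible_X_sub_C (1 : F)).coprime_iff_not_dvd, dvd_iff_isRoot]
    simp [hm]
  obtain ⟨a, b, hab⟩ := hcop
  refine ⟨a, ?_⟩
  have h : (X : F[X]) - C 1 = (X ^ m - 1) * a + (X - C 1) ^ k * (b * (X - C 1)) := by
    have := geom_sum_mul (X : F[X]) m
    rw [C_1] at *
    linear_combination (-(X - 1)) * hab + a * this
  have h2 := congrArg (aeval x) h
  simpa [hk] using h2

open Polynomial in
/-- If `s` is a left period of the character of `ρ`, then `ρ s - 1` is orthogonal, for the trace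
form, to the algebra generated by the image of `ρ`. -/
theorem Representation.trace_sub_one_mul_aeval_mul [FiniteDimensional F V]
    (ρ : Representation F G V) (τ : G → ℚ) (hτ : ∀ s, LinearMap.trace F V (ρ s) = τ s)
    {s : G} (hs : s ∈ leftPeriods τ) (r t : G) (f : F[X]) :
    LinearMap.trace F V ((ρ s - 1) * (aeval (ρ r) f * ρ t)) = 0 := by
  induction f using Polynomial.induction_on' with
  | add p q hp hq => rw [map_add, add_mul, mul_add, map_add, hp, hq, add_zero]
  | monomial n a =>
    rw [aeval_monomial, ← Algebra.smul_def, smul_mul_assoc, mul_smul_comm, map_smul, ← map_pow,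
      ← map_mul, sub_mul, one_mul, ← map_mul, map_sub, hτ, hτ, hs, sub_self, smul_zero]

open Polynomial in
/-- If the left periods of the character of `ρ` have finite index, then they are exactly the
elements acting unipotently. -/
theorem Representation.mem_leftPeriods_iff [FiniteDimensional F V] [CharZero F]
    (ρ : Representation F G V) (τ : G → ℚ) (hτ : ∀ s, LinearMap.trace F V (ρ s) = τ s)
    [(leftPeriods τ).FiniteIndex] (s : G) : s ∈ leftPeriods τ ↔ IsNilpotent (ρ s - 1) := by
  constructor
  · intro hs
    refine Module.End.isNilpotent_of_forall_trace_pow_eq_zero _ fun n => ?_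
    have := ρ.trace_sub_one_mul_aeval_mul τ hτ hs s 1 ((X - 1) ^ n)
    simpa [pow_succ'] using this
  · intro hs t
    -- A power of `s` is a period, and `ρ s - 1` is a multiple of `ρ (s ^ m) - 1`.
    obtain ⟨m, hm, -, hmem⟩ := Subgroup.exists_pow_mem_of_index_ne_zero
      (Subgroup.FiniteIndex.index_ne_zero (H := leftPeriods τ)) s
    obtain ⟨a, ha⟩ := exists_aeval_mul_pow_sub_one (F := F) hs hm.ne'
    have := ρ.trace_sub_one_mul_aeval_mul τ hτ hmem s t a
    rw [map_pow, ← mul_assoc, ← ha, sub_mul, one_mul, ← map_mul, map_sub, hτ, hτ, sub_eq_zero]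
      at this
    exact Rat.cast_injective this

end Representation

/-! ### Minkowski's lemma on unipotent elements congruent to `1` -/

section Minkowski

theorem exists_geom_sum_eq_natCast_add {A : Type*} [CommRing A] (ℓ q : ℕ) (x : A) :
    ∃ y : A, ∑ i ∈ Finset.range q, (1 + ℓ * x) ^ i = q + ℓ * y := by
  have h : ∀ i : ℕ, ∃ y : A, (1 + ℓ * x) ^ i = 1 + ℓ * y := by
    intro i
    induction i with
    | zero => exact ⟨0, by simp⟩
    | succ i ih =>
      obtain ⟨y, hy⟩ := ih
      exact ⟨x + y * (1 + ℓ * x), by rw [pow_succ, hy]; ring⟩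
  choose y hy using h
  refine ⟨∑ i ∈ Finset.range q, y i, ?_⟩
  simp [hy, Finset.sum_add_distrib, Finset.mul_sum]

/-- When the number of terms is `ℓ` itself and `ℓ` is odd, the term of degree one in `x` is
`ℓ * x * (ℓ * (ℓ - 1) / 2)`, divisible by `ℓ ^ 2`; this fails for `ℓ = 2`, whence the stronger
congruence modulo `4`. -/
theorem exists_geom_sum_eq_natCast_mul {A : Type*} [CommRing A] {ℓ : ℕ} (hℓ : ℓ.Prime) (x : A) :
    ∃ y : A, ∑ i ∈ Finset.range ℓ, (1 + (ℓ : A) ^ (if ℓ = 2 then 2 else 1) * x) ^ i =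
      ℓ * (1 + ℓ * y) := by
  split_ifs with h2
  · subst h2
    exact ⟨x, by simp [Finset.sum_range_succ]; ring⟩
  · obtain ⟨k, hk⟩ := hℓ.odd_of_ne_two h2
    have h : ∀ i : ℕ, ∃ y : A, (1 + ℓ ^ 1 * x) ^ i = 1 + i * (ℓ * x) + ℓ ^ 2 * y := by
      intro i
      induction i with
      | zero => exact ⟨0, by simp⟩
      | succ i ih =>
        obtain ⟨y, hy⟩ := ih
        exact ⟨i * x ^ 2 + y * (1 + ℓ * x), by rw [pow_succ, hy]; push_cast; ring⟩
    choose y hy using h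
    refine ⟨k * x + ∑ i ∈ Finset.range ℓ, y i, ?_⟩
    have hsum : ∑ i ∈ Finset.range ℓ, i = ℓ * k := by
      have := Finset.sum_range_id_mul_two ℓ
      rw [show ℓ - 1 = 2 * k by omega] at this
      linarith
    have hsum' : ∑ i ∈ Finset.range ℓ, (i : A) = ℓ * k := by
      rw [← Nat.cast_sum, hsum, Nat.cast_mul]
    simp only [hy, Finset.sum_add_distrib, ← Finset.mul_sum, ← Finset.sum_mul, hsum']
    simp
    ring

variable {S : Type*} [Ring S]

/-- A factor `w` which is not a left zero divisor can be cancelled from a nilpotent product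
`x * w` of commuting elements. -/
theorem IsNilpotent.of_mul_of_left_regular {x w : S} (h : Commute x w)
    (hw : ∀ z, w * z = 0 → z = 0) (hxw : IsNilpotent (x * w)) : IsNilpotent x := by
  obtain ⟨k, hk⟩ := hxw
  refine ⟨k, ?_⟩
  have hpow : ∀ j : ℕ, ∀ z, w ^ j * z = 0 → z = 0 := by
    intro j
    induction j with
    | zero => simp
    | succ j ih => exact fun z hz => hw z (ih _ (by rwa [← mul_assoc, ← _root_.pow_succ]))
  exact hpow k _ (by rw [← (h.pow_pow k k).eq, ← h.mul_pow, hk])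

open Polynomial in
/-- Minkowski's lemma, in a ring `S` in which `ℓ` is not a zero divisor and lies in the Jacobson
radical: an element congruent to `1` modulo `ℓ` (modulo `4` if `ℓ = 2`) which has a unipotent power
is unipotent. For a prime exponent `q` one writes `x ^ q - 1 = (x - 1) * W` with `W` the geometric
sum, which is a unit if `q ≠ ℓ` and `ℓ` times a unit if `q = ℓ`. -/
theorem isNilpotent_of_isNilpotent_pow_sub_one {ℓ : ℕ} (hℓ : ℓ.Prime)
    (hunit : ∀ y : S, IsUnit (1 + (ℓ : S) * y)) (hreg : ∀ y : S, (ℓ : S) * y = 0 → y = 0)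
    {m : ℕ} (hm : m ≠ 0) (M : S)
    (h : IsNilpotent ((1 + (ℓ : S) ^ (if ℓ = 2 then 2 else 1) * M) ^ m - 1)) :
    IsNilpotent ((ℓ : S) ^ (if ℓ = 2 then 2 else 1) * M) := by
  set n := if ℓ = 2 then 2 else 1 with hn
  induction m using induction_on_primes generalizing M with
  | zero => exact absurd rfl hm
  | one => simpa using h
  | prime_mul q m hq ih =>
    set W : S := ∑ i ∈ Finset.range q, (1 + (ℓ : S) ^ n * M) ^ i with hW
    have hcomm : Commute M W := by
      refine Commute.sum_right _ _ _ fun i _ => Commute.pow_right ?_ i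
      exact (Commute.one_right M).add_right
        (((Nat.cast_commute ℓ M).symm.pow_right n).mul_right (Commute.refl M))
    have hcomm' : Commute ((ℓ : S) ^ n * M) W :=
      ((Nat.cast_commute ℓ W).pow_left n).mul_left hcomm
    have hpow : (1 + (ℓ : S) ^ n * M) ^ q = 1 + (ℓ : S) ^ n * (M * W) := by
      have := mul_geom_sum (1 + (ℓ : S) ^ n * M) q
      rw [← hW, add_sub_cancel_left, mul_assoc] at this
      rw [this, add_sub_cancel]
    refine IsNilpotent.of_mul_of_left_regular hcomm' ?_ ?_
    · have hunit' : ∀ y z : S, (1 + (ℓ : S) * y) * z = 0 → z = 0 :=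
        fun y z hz => (hunit y).mul_right_eq_zero.mp hz
      intro z hz
      rcases eq_or_ne q ℓ with rfl | hne
      · -- The identities are proved in the commutative ring `ℤ[X]` and specialised at `M`.
        obtain ⟨y, hy⟩ := exists_geom_sum_eq_natCast_mul hℓ (X : ℤ[X])
        rw [← hn] at hy
        have hWy : W = q * (1 + q * aeval M y) := by
          simpa [hW] using congrArg (aeval M) hy
        rw [hWy, mul_assoc] at hz
        exact hunit' _ _ (hreg _ hz)
      · -- Here `W` is congruent to `q` modulo `ℓ`, and `q` is invertible modulo `ℓ`.
        obtain ⟨y, hy⟩ := exists_geom_sum_eq_natCast_add ℓ q ((ℓ : ℤ[X]) ^ (n - 1) * X)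
        have hn1 : n = n - 1 + 1 := by rw [hn]; split_ifs <;> rfl
        rw [← mul_assoc, ← pow_succ', ← hn1] at hy
        have hWy : W = q + ℓ * aeval M y := by
          simpa [hW] using congrArg (aeval M) hy
        obtain ⟨a, b, hab⟩ := Nat.isCoprime_iff_coprime.mpr ((Nat.coprime_primes hq hℓ).mpr hne)
        refine hunit' (a * aeval M y - b) z ?_
        have hab' : (a : S) * q + b * ℓ = 1 := by exact_mod_cast congrArg (Int.cast : ℤ → S) hab
        have : 1 + (ℓ : S) * (a * aeval M y - b) = a * W := by
          rw [hWy, ← hab', mul_sub, mul_add, ← mul_assoc, ← mul_assoc,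
            (Nat.cast_commute ℓ (a : S)).eq, (Nat.cast_commute ℓ (b : S)).eq]
          abel
        rw [this, mul_assoc, hz, mul_zero]
    · rw [mul_assoc]
      refine ih (by rintro rfl; simp at hm) (M * W) ?_
      rwa [← hpow, ← pow_mul]

end Minkowski

/-! ### Stable lattices and reduction -/

section Reduction

open Module

section Lattice

variable {ℓ : ℕ} [Fact ℓ.Prime] {G V : Type*} [Group G] [TopologicalSpace G] [CompactSpace G]
  [AddCommGroup V] [Module ℚ_[ℓ] V] [FiniteDimensional ℚ_[ℓ] V]
  [TopologicalSpace V] [IsModuleTopology ℚ_[ℓ] V]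

/-- A continuous `ℓ`-adic representation of a compact group has a stable lattice: the
`ℤ_[ℓ]`-span of the orbits of a basis, which is finitely generated because the coordinates of
these orbits are bounded. -/
theorem Representation.exists_padicInt_lattice [Module ℤ_[ℓ] V] [IsScalarTower ℤ_[ℓ] ℚ_[ℓ] V]
    (ρ : Representation ℚ_[ℓ] G V) (hcont : ∀ v, Continuous fun s => ρ s v) :
    ∃ L : Submodule ℤ_[ℓ] V, Submodule.IsLattice ℚ_[ℓ] L ∧ ∀ s, ∀ v ∈ L, ρ s v ∈ L := by
  set e := Module.finBasis ℚ_[ℓ] V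
  set L : Submodule ℤ_[ℓ] V := Submodule.span ℤ_[ℓ] (Set.range fun x : G × _ => ρ x.1 (e x.2))
  have hbdd : ∀ x : Fin (finrank ℚ_[ℓ] V) × Fin (finrank ℚ_[ℓ] V),
      ∃ C : ℝ, ∀ s, ‖e.coord x.1 (ρ s (e x.2))‖ ≤ C := by
    intro x
    have hc : Continuous fun s => ‖e.coord x.1 (ρ s (e x.2))‖ :=
      ((IsModuleTopology.continuous_of_linearMap (e.coord x.1)).comp (hcont _)).norm
    obtain ⟨C, hC⟩ := (isCompact_range hc).bddAbove
    exact ⟨C, fun s => hC ⟨s, rfl⟩⟩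
  choose C hC using hbdd
  have hsmul : ∀ (z : ℤ_[ℓ]) (v : V), (z : ℚ_[ℓ]) • v = z • v :=
    IsScalarTower.algebraMap_smul ℚ_[ℓ]
  have hℓ0 : (ℓ : ℚ_[ℓ]) ≠ 0 := Nat.cast_ne_zero.mpr (Fact.out : ℓ.Prime).ne_zero
  obtain ⟨n, hn⟩ := pow_unbounded_of_one_lt (∑ x, |C x|)
    (Nat.one_lt_cast.mpr (Fact.out : ℓ.Prime).one_lt)
  have hle : L ≤ Submodule.span ℤ_[ℓ] (Set.range fun i => ((ℓ : ℚ_[ℓ]) ^ n)⁻¹ • e i) := by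
    refine Submodule.span_le.mpr ?_
    rintro _ ⟨⟨s, j⟩, rfl⟩
    have hsum : ρ s (e j) = ∑ i, ((ℓ : ℚ_[ℓ]) ^ n * e.coord i (ρ s (e j))) •
        (((ℓ : ℚ_[ℓ]) ^ n)⁻¹ • e i) := by
      conv_lhs => rw [← e.sum_repr (ρ s (e j))]
      refine Finset.sum_congr rfl fun i _ => ?_
      rw [smul_smul, mul_right_comm, mul_inv_cancel₀ (pow_ne_zero n hℓ0), one_mul, e.coord_apply]
    change ρ s (e j) ∈ _
    rw [hsum]
    refine Submodule.sum_mem _ fun i _ => ?_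
    have hnorm : ‖(ℓ : ℚ_[ℓ]) ^ n * e.coord i (ρ s (e j))‖ ≤ 1 := by
      have h1 : ‖e.coord i (ρ s (e j))‖ ≤ (ℓ : ℝ) ^ n :=
        (hC (i, j) s).trans <| (le_abs_self _).trans <|
          (Finset.single_le_sum (f := fun x => |C x|) (fun x _ => abs_nonneg _)
            (Finset.mem_univ (i, j))).trans hn.le
      have h0 : (0 : ℝ) < (ℓ : ℝ) ^ n := pow_pos (Nat.cast_pos.mpr (Fact.out : ℓ.Prime).pos) n
      rw [norm_mul, norm_pow, Padic.norm_p, inv_pow, inv_mul_le_iff₀ h0, mul_one]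
      exact h1
    have := Submodule.smul_mem
      (Submodule.span ℤ_[ℓ] (Set.range fun i => ((ℓ : ℚ_[ℓ]) ^ n)⁻¹ • e i))
      (⟨_, hnorm⟩ : ℤ_[ℓ]) (Submodule.subset_span ⟨i, rfl⟩)
    exact (congrArg (· ∈ _) (hsmul ⟨_, hnorm⟩ _)).mpr this
  refine ⟨L, ⟨?_, ?_⟩, ?_⟩
  · have : Module.Finite ℤ_[ℓ] (Submodule.span ℤ_[ℓ]
      (Set.range fun i => ((ℓ : ℚ_[ℓ]) ^ n)⁻¹ • e i)) :=
      Module.Finite.span_of_finite _ (Set.finite_range _)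
    have := isNoetherian_of_le hle
    exact Module.Finite.iff_fg.mp inferInstance
  · rw [eq_top_iff, ← e.span_eq]
    refine Submodule.span_mono ?_
    rintro _ ⟨i, rfl⟩
    exact Submodule.subset_span ⟨(1, i), by simp⟩
  · intro s v hv
    induction hv using Submodule.span_induction with
    | mem v hv =>
      obtain ⟨⟨t, i⟩, rfl⟩ := hv
      exact Submodule.subset_span ⟨(s * t, i), by simp⟩
    | zero => simp
    | add v w _ _ hv hw => rw [map_add]; exact add_mem hv hw
    | smul c v _ hv =>
      rw [← hsmul, map_smul, hsmul]
      exact Submodule.smul_mem _ c hv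

/-- In a basis of a stable lattice, a compact group acts through matrices over `ℤ_[ℓ]`. -/
theorem Representation.exists_padicInt_matrix
    (ρ : Representation ℚ_[ℓ] G V) (hcont : ∀ v, Continuous fun s => ρ s v) :
    ∃ (b : Basis (Fin (finrank ℚ_[ℓ] V)) ℚ_[ℓ] V)
      (A : G →* Matrix (Fin (finrank ℚ_[ℓ] V)) (Fin (finrank ℚ_[ℓ] V)) ℤ_[ℓ]),
      ∀ s, (A s).map (algebraMap ℤ_[ℓ] ℚ_[ℓ]) = LinearMap.toMatrix b b (ρ s) := by
  let _ : Module ℤ_[ℓ] V := Module.compHom V (algebraMap ℤ_[ℓ] ℚ_[ℓ])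
  have : IsScalarTower ℤ_[ℓ] ℚ_[ℓ] V := IsScalarTower.of_compHom ..
  obtain ⟨L, hL, hρ⟩ := ρ.exists_padicInt_lattice hcont
  have hrank : finrank ℤ_[ℓ] L = finrank ℚ_[ℓ] V :=
    congrArg Cardinal.toNat (Submodule.IsLattice.rank' ℚ_[ℓ] L)
  let b₀ : Basis (Fin (finrank ℚ_[ℓ] V)) ℤ_[ℓ] L := Module.finBasisOfFinrankEq ℤ_[ℓ] L hrank
  let σ : G →* Module.End ℤ_[ℓ] L :=
    { toFun := fun s => ((ρ s).restrictScalars ℤ_[ℓ]).restrict (hρ s)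
      map_one' := by ext; simp
      map_mul' := fun s t => LinearMap.ext fun v =>
        Subtype.ext (LinearMap.congr_fun (map_mul ρ s t) v) }
  refine ⟨b₀.extendOfIsLattice ℚ_[ℓ],
    (LinearMap.toMatrixAlgEquiv b₀ : _ →* Matrix _ _ ℤ_[ℓ]).comp σ, fun s => ?_⟩
  ext i j
  have h : ρ s (b₀.extendOfIsLattice ℚ_[ℓ] j) =
      ∑ i, algebraMap ℤ_[ℓ] ℚ_[ℓ] (b₀.repr (σ s (b₀ j)) i) • b₀.extendOfIsLattice ℚ_[ℓ] i := by
    have := congrArg (Subtype.val : L → V) (b₀.sum_repr (σ s (b₀ j)))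
    simp only [Submodule.coe_sum, Submodule.coe_smul] at this
    simp only [Basis.extendOfIsLattice_apply, IsScalarTower.algebraMap_smul]
    exact this.symm
  rw [LinearMap.toMatrix_apply, h, Basis.repr_sum_self]
  simp [LinearMap.toMatrixAlgEquiv_apply]

end Lattice

/-- The determinant of `1 + ℓ * Y` is congruent to `1` modulo `ℓ`. -/
theorem PadicInt.isUnit_one_add_natCast_mul_matrix {ℓ : ℕ} [Fact ℓ.Prime] {ι : Type*} [Fintype ι]
    [DecidableEq ι] (Y : Matrix ι ι ℤ_[ℓ]) : IsUnit (1 + (ℓ : Matrix ι ι ℤ_[ℓ]) * Y) := by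
  rw [Matrix.isUnit_iff_isUnit_det]
  by_contra h
  have h1 : PadicInt.toZMod (1 + (ℓ : Matrix ι ι ℤ_[ℓ]) * Y).det = 0 := by
    rw [← RingHom.mem_ker, PadicInt.ker_toZMod]
    exact (IsLocalRing.mem_maximalIdeal _).mpr h
  rw [RingHom.map_det, map_add, map_mul, map_natCast, map_one,
    show (ℓ : Matrix ι ι (ZMod ℓ)) = 0 by
      rw [← map_natCast (Matrix.scalar ι), ZMod.natCast_self, map_zero],
    zero_mul, add_zero, Matrix.det_one] at h1
  exact one_ne_zero h1

theorem glOrder_eq (ℓ d : ℕ) :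
    glOrder ℓ d = Nat.card (GL (Fin d) (ZMod (ℓ ^ (if ℓ = 2 then 2 else 1)))) := by
  unfold glOrder
  split_ifs with h
  · subst h; rfl
  · have hcard : ∀ m, m = ℓ →
        Nat.card (GL (Fin d) (ZMod ℓ)) = Nat.card (GL (Fin d) (ZMod m)) := by
      rintro _ rfl; rfl
    exact hcard _ (by rw [if_neg h, pow_one])

/-- If the elements acting unipotently form a subgroup of finite index, this index divides
`C_{ℓ,d}`: by Minkowski's lemma that subgroup contains the kernel of the action on a stable lattice
modulo `ℓ` (modulo `4` if `ℓ = 2`). -/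
theorem Representation.index_dvd_glOrder {ℓ : ℕ} [Fact ℓ.Prime] {G V : Type*} [Group G]
    [TopologicalSpace G] [CompactSpace G]
    [AddCommGroup V] [Module ℚ_[ℓ] V] [FiniteDimensional ℚ_[ℓ] V]
    [TopologicalSpace V] [IsModuleTopology ℚ_[ℓ] V]
    (ρ : Representation ℚ_[ℓ] G V) (hcont : ∀ v, Continuous fun s => ρ s v)
    (I : Subgroup G) [I.FiniteIndex] (hI : ∀ s, s ∈ I ↔ IsNilpotent (ρ s - 1)) :
    I.index ∣ glOrder ℓ (finrank ℚ_[ℓ] V) := by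
  have hℓ : ℓ.Prime := Fact.out
  obtain ⟨b, A, hA⟩ := ρ.exists_padicInt_matrix hcont
  generalize finrank ℚ_[ℓ] V = d at b A hA ⊢
  set n := if ℓ = 2 then 2 else 1 with hn
  have hinj : Function.Injective ((algebraMap ℤ_[ℓ] ℚ_[ℓ]).mapMatrix (m := Fin d)) :=
    Matrix.map_injective (FaithfulSMul.algebraMap_injective _ _)
  have hnil : ∀ s, IsNilpotent (ρ s - 1) ↔ IsNilpotent (A s - 1) := by
    intro s
    rw [← IsNilpotent.map_iff hinj, map_sub, map_one, RingHom.mapMatrix_apply, hA,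
      ← IsNilpotent.map_iff (LinearMap.toMatrixAlgEquiv b).injective, map_sub, map_one]
    rfl
  let r : G →* GL (Fin d) (ZMod (ℓ ^ n)) :=
    (((PadicInt.toZModPow (p := ℓ) n).mapMatrix (m := Fin d) : _ →* _).comp A).toHomUnits
  have hker : r.ker ≤ I := by
    intro s hs
    obtain ⟨m, hm, -, hmem⟩ := Subgroup.exists_pow_mem_of_index_ne_zero
      (Subgroup.FiniteIndex.index_ne_zero (H := I)) s
    rw [hI, hnil, map_pow] at hmem
    rw [hI, hnil]
    have hs1 : (PadicInt.toZModPow n).mapMatrix (A s) = 1 := congrArg Units.val hs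
    have hdvd : ∀ i j, ∃ x, (A s - 1) i j = (ℓ : ℤ_[ℓ]) ^ n * x := by
      intro i j
      have : (A s - 1) i j ∈ RingHom.ker (PadicInt.toZModPow (p := ℓ) n) := by
        have h0 : (PadicInt.toZModPow n).mapMatrix (A s - 1) = 0 := by
          rw [map_sub, hs1, map_one, sub_self]
        exact congrFun (congrFun h0 i) j
      rw [PadicInt.ker_toZModPow, Ideal.mem_span_singleton] at this
      exact this
    choose M hM using hdvd
    have hAM : A s - 1 = (ℓ : Matrix (Fin d) (Fin d) ℤ_[ℓ]) ^ n * Matrix.of M := by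
      ext i j
      have : ((ℓ : Matrix (Fin d) (Fin d) ℤ_[ℓ]) ^ n * Matrix.of M) = (ℓ ^ n) • Matrix.of M := by
        rw [nsmul_eq_mul, Nat.cast_pow]
      rw [hM, this, Matrix.smul_apply, nsmul_eq_mul, Nat.cast_pow, Matrix.of_apply]
    rw [hAM]
    refine isNilpotent_of_isNilpotent_pow_sub_one hℓ
      PadicInt.isUnit_one_add_natCast_mul_matrix ?_ hm.ne' (Matrix.of M) ?_
    · intro Y hY
      rw [← nsmul_eq_mul] at hY
      ext i j
      have := congrFun (congrFun hY i) j
      rw [Matrix.smul_apply, nsmul_eq_mul] at this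
      exact (mul_eq_zero.mp this).resolve_left (Nat.cast_ne_zero.mpr hℓ.ne_zero)
    · rwa [← hAM, add_sub_cancel]
  rw [glOrder_eq]
  refine (Subgroup.index_dvd_of_le hker).trans ?_
  rw [Subgroup.index_ker]
  exact Subgroup.card_subgroup_dvd_card _

end Reduction

/-! ### Inertia and continuity of the trace -/

/-- Inertia is closed, since the orbit maps `σ ↦ σ • x` are locally constant. -/
theorem isClosed_inertiaGroup (R K Ksep : Type*) [CommRing R] [Field K] [Algebra R K]
    [Field Ksep] [Algebra K Ksep] [Algebra R Ksep] [IsScalarTower R K Ksep]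
    [Algebra.IsIntegral K Ksep] :
    IsClosed (inertiaGroup R K Ksep : Set Gal(Ksep/K)) := by
  have hopen : ∀ (x : integralClosure R Ksep) (T : Set (integralClosure R Ksep)),
      IsOpen {σ : Gal(Ksep/K) | σ • x ∈ T} := by
    intro x T
    have heq : {σ : Gal(Ksep/K) | σ • x ∈ T} = ⋃ τ ∈ {τ : Gal(Ksep/K) | τ • x ∈ T},
        (fun σ => τ⁻¹ * σ) ⁻¹' (MulAction.stabilizer Gal(Ksep/K) (x : Ksep) : Set _) := by
      ext σ
      simp only [Set.mem_iUnion, Set.mem_preimage, SetLike.mem_coe, MulAction.mem_stabilizer_iff]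
      constructor
      · exact fun h => ⟨σ, h, by simp⟩
      · rintro ⟨τ, hτ, h⟩
        have : σ • x = τ • x := by
          apply Subtype.ext
          rw [mul_smul, inv_smul_eq_iff] at h
          exact h
        rw [Set.mem_ofPred_eq, this]
        exact hτ
    rw [heq]
    exact isOpen_biUnion fun τ _ =>
      (stabilizer_isOpen_of_isIntegral (x : Ksep)).preimage (continuous_const_mul τ⁻¹)
  have heq : (inertiaGroup R K Ksep : Set Gal(Ksep/K)) =
      ⋂ x : integralClosure R Ksep,
        {σ | σ • x ∈ {y | y - x ∉ Ring.jacobson (integralClosure R Ksep)}}ᶜ := by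
    ext σ
    simp [inertiaGroup, AddSubgroup.mem_inertia]
  rw [heq]
  exact isClosed_iInter fun x => (hopen x _).isClosed_compl

theorem Representation.continuous_trace {ℓ : ℕ} [Fact ℓ.Prime] {G V : Type*} [Group G]
    [TopologicalSpace G] [AddCommGroup V] [Module ℚ_[ℓ] V] [FiniteDimensional ℚ_[ℓ] V]
    [TopologicalSpace V] [IsModuleTopology ℚ_[ℓ] V]
    (ρ : Representation ℚ_[ℓ] G V) (hcont : ∀ v, Continuous fun s => ρ s v) :
    Continuous fun s => LinearMap.trace ℚ_[ℓ] V (ρ s) := by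
  let e := Module.finBasis ℚ_[ℓ] V
  simp only [LinearMap.trace_eq_matrix_trace ℚ_[ℓ] e, Matrix.trace, Matrix.diag,
    LinearMap.toMatrix_apply]
  exact continuous_finsetSum _ fun i _ =>
    (IsModuleTopology.continuous_of_linearMap (e.coord i)).comp (hcont (e i))

theorem corollary1
    -- a complete discretely valued field `K` with valuation ring `R`
    {R K : Type*} [CommRing R] [IsDomain R] [IsDiscreteValuationRing R]
    [IsAdicComplete (IsLocalRing.maximalIdeal R) R]
    [Field K] [Algebra R K] [IsFractionRing R K]
    -- a separable closure of `K`
    {Ksep : Type*} [Field Ksep] [Algebra K Ksep] [IsSepClosure K Ksep]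
    [Algebra R Ksep] [IsScalarTower R K Ksep]
    -- the residue field
    (p : ℕ) [CharP (IsLocalRing.ResidueField R) p] [PerfectField (IsLocalRing.ResidueField R)]
    (hC : ∀ ℓ : PrimeNe p,
      NoFiniteExtensionContainsRootsOfUnity ℓ.1 (IsLocalRing.ResidueField R))
    -- a family of `ℓ`-adic representations of `Gal(Ksep/K)`
    {V : PrimeNe p → Type*} [∀ ℓ, AddCommGroup (V ℓ)] [∀ ℓ, Module ℚ_[ℓ.1] (V ℓ)]
    [∀ ℓ, FiniteDimensional ℚ_[ℓ.1] (V ℓ)]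
    [∀ ℓ, TopologicalSpace (V ℓ)] [∀ ℓ, IsModuleTopology ℚ_[ℓ.1] (V ℓ)]
    (ρ : ∀ ℓ : PrimeNe p, Representation ℚ_[ℓ.1] Gal(Ksep/K) (V ℓ))
    (hcont : ∀ ℓ, Continuous fun x : Gal(Ksep/K) × V ℓ => ρ ℓ x.1 x.2)
    -- the traces on the inertia group are rational and independent of `ℓ`
    (htr : ∀ s ∈ inertiaGroup R K Ksep, ∃ q : ℚ, ∀ ℓ : PrimeNe p,
      LinearMap.trace ℚ_[ℓ.1] (V ℓ) (ρ ℓ s) = (q : ℚ_[ℓ.1])) :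
    ∃ d : ℕ, (∀ ℓ : PrimeNe p, Module.finrank ℚ_[ℓ.1] (V ℓ) = d) ∧
      ∃ I : Subgroup (inertiaGroup R K Ksep),
        (∀ (ℓ : PrimeNe p) (s : inertiaGroup R K Ksep),
          s ∈ I ↔ IsNilpotent (ρ ℓ s.1 - 1)) ∧
        I.index ∣ glOrderGcd p d := by
  choose! q hq using htr
  let τ : inertiaGroup R K Ksep → ℚ := fun s => q s
  let σ : ∀ ℓ : PrimeNe p, Representation ℚ_[ℓ.1] (inertiaGroup R K Ksep) (V ℓ) :=
    fun ℓ => (ρ ℓ).comp (inertiaGroup R K Ksep).subtype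
  have hτ : ∀ ℓ s, LinearMap.trace ℚ_[ℓ.1] (V ℓ) (σ ℓ s) = (τ s : ℚ_[ℓ.1]) :=
    fun ℓ s => hq s.1 s.2 ℓ
  have hσ : ∀ ℓ v, Continuous fun s => σ ℓ s v := fun ℓ v =>
    (hcont ℓ).comp (continuous_subtype_val.prodMk continuous_const)
  have : IsGalois K Ksep := IsSepClosure.isGalois
  have : CompactSpace (inertiaGroup R K Ksep) :=
    isCompact_iff_compactSpace.mp (isClosed_inertiaGroup R K Ksep).isCompact
  have hdim : ∀ ℓ : PrimeNe p, (Module.finrank ℚ_[ℓ.1] (V ℓ) : ℚ) = τ 1 := by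
    intro ℓ
    have := hτ ℓ 1
    rw [map_one, LinearMap.trace_one] at this
    exact_mod_cast this
  obtain ⟨l₀⟩ : Nonempty (PrimeNe p) := by
    obtain ⟨ℓ₀, hℓ₀, hprime⟩ := Nat.exists_infinite_primes (p + 1)
    exact ⟨ℓ₀, hprime, by omega⟩
  have hfin : (leftPeriods τ).FiniteIndex :=
    (σ l₀).finiteIndex_leftPeriods τ (hτ l₀) ((σ l₀).continuous_trace (hσ l₀))
  have hdim' : ∀ ℓ : PrimeNe p, Module.finrank ℚ_[ℓ.1] (V ℓ) = Module.finrank ℚ_[l₀.1] (V l₀) := by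
    intro ℓ
    exact_mod_cast (hdim ℓ).trans (hdim l₀).symm
  refine ⟨_, hdim', leftPeriods τ, fun ℓ s => (σ ℓ).mem_leftPeriods_iff τ (hτ ℓ) s, ?_⟩
  rw [dvd_glOrderGcd_iff]
  intro ℓ
  rw [← hdim' ℓ]
  exact (σ ℓ).index_dvd_glOrder (hσ ℓ) _ fun s => (σ ℓ).mem_leftPeriods_iff τ (hτ ℓ) s
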